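/- Let $R$ be a ring with $n \ge 2$ links, where every link $e$ has a latency function $\ell_e(x) = a_e x + b_e$ with real constants $a_e, b_e \ge 0$, and let agents $1, \dots, k$ be given, agent $i$ with a source $s_i$ and a destination $t_i \ne s_i$ on $R$. A routing $\pi = (P_1, \dots, P_k)$ chooses for every agent $i$ one of the two paths on $R$ between $s_i$ and $t_i$. For a set $P$ of links let $\ell(P,\pi) = \sum_{e \in P} \bigl(a_e\,|\{i : e \in P_i\}| + b_e\bigr)$, and let $M(\pi) = \max_i \ell(P_i,\pi)$. The routing $\pi$ is a Nash equilibrium if no agent $i$ can reduce its latency $\ell(P_i,\pi)$ by switching from $P_i$ to the alternative path $R \setminus P_i$ while all other agents keep their paths; it is optimal if it minimizes $M$ among all routings. Theorem 3. Let $\pi^N = (N_1, \dots, N_k)$ be a Nash equilibrium, and let $\pi^* = (Q_1, \dots, Q_k)$ be an optimal routing that, among all optimal routings, minimizes the number of switching agents, i.e. of agents $i$ with $N_i \ne Q_i$. If $\pi^N$ is covering, i.e. $\bigcup_{i : N_i \ne Q_i} N_i = R$ (as sets of links), then the total latency of the ring in $\pi^N$ is at most three times the optimal maximum latency: $$\ell(R,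 \pi^N) \le 3\, M(\pi^*).$$ -/

import Mathlib

/-- A selfish ring routing instance: a ring with nodes `0, …, n - 1`, whose link `e` joins the nodes
`e` and `e + 1` (modulo `n`) and has the latency function `x ↦ a e * x + b e`, and `k` agents,
agent `i` having the source `src i` and the destination `dst i`. -/
structure RingInstance (n k : ℕ) where
  two_le : 2 ≤ n
  a : Fin n → ℝ
  b : Fin n → ℝ
  a_nonneg : ∀ e, 0 ≤ a e
  b_nonneg : ∀ e, 0 ≤ b e
  src : Fin k → Fin n
  dst : Fin k → Fin n
  src_ne_dst : ∀ i, src i ≠ dst i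

/-- The link set of the path that starts at `s` and runs in the direction `s, s + 1, s + 2, …`
(modulo `n`) until it reaches `t`. -/
def ringArc {n : ℕ} (s t : Fin n) : Finset (Fin n) :=
  Finset.univ.filter fun e => e - s < t - s

/-- `P` is the link set of a path on the ring between the distinct nodes `s` and `t`. -/
def IsRingPath {n : ℕ} (s t : Fin n) (P : Finset (Fin n)) : Prop :=
  P = ringArc s t ∨ P = ringArc t s

/-- The two paths between distinct nodes are complementary, so `Pᶜ` is the alternative path. -/
theorem ringArc_compl {n : ℕ} {s t : Fin n} (h : s ≠ t) : (ringArc s t)ᶜ = ringArc t s := by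
  ext e
  simp only [ringArc, Finset.mem_compl, Finset.mem_filter, Finset.mem_univ, true_and, Fin.lt_def]
  have h' : s.val ≠ t.val := fun q => h (Fin.ext q)
  rw [Fin.sub_def, Fin.sub_def, Fin.sub_def, Fin.sub_def]
  have key : ∀ x y : Fin n, (n - y.val + x.val) % n =
      if y.val ≤ x.val then x.val - y.val else n - y.val + x.val := by
    intro x y
    have := x.isLt
    have := y.isLt
    split_ifs with hxy
    · rw [show n - y.val + x.val = (x.val - y.val) + n by omega, Nat.add_mod_right]
      exact Nat.mod_eq_of_lt (by omega)
    · exact Nat.mod_eq_of_lt (by omega)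
  simp only [key]
  have := e.isLt
  have := s.isLt
  have := t.isLt
  split_ifs <;> omega

namespace RingInstance

variable {n k : ℕ}

/-- A feasible routing: every agent uses a path between its source and its destination. -/
def IsRouting (I : RingInstance n k) (π : Fin k → Finset (Fin n)) : Prop :=
  ∀ i, IsRingPath (I.src i) (I.dst i) (π i)

/-- The latency `ℓ(P, π)` of a set `P` of links in the routing `π`. -/
def latency (I : RingInstance n k) (P : Finset (Fin n)) (π : Fin k → Finset (Fin n)) : ℝ :=
  ∑ e ∈ P, (I.a e * ((Finset.univ.filter fun i => e ∈ π i).card : ℝ) + I.b e)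

/-- The maximum latency `M(π)` of an agent (a maximum over a finite set). -/
noncomputable def maxLatency (I : RingInstance n k) (π : Fin k → Finset (Fin n)) : ℝ :=
  ⨆ i : Fin k, I.latency (π i) π

/-- `π` is a Nash equilibrium: no agent can reduce its latency by switching to the alternative path
while the other agents keep their paths. -/
def IsNash (I : RingInstance n k) (π : Fin k → Finset (Fin n)) : Prop :=
  I.IsRouting π ∧
    ∀ i, I.latency (π i) π ≤ I.latency (π i)ᶜ (Function.update π i (π i)ᶜ)

/-- `π` is an optimal routing: it minimizes the maximum latency. -/
def IsOptimal (I : RingInstance n k) (π : Fin k → Finset (Fin n)) : Prop :=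
  I.IsRouting π ∧ ∀ π' : Fin k → Finset (Fin n), I.IsRouting π' → I.maxLatency π ≤ I.maxLatency π'

end RingInstance

/-- The agents that use different paths in `πN` and in `π`. -/
def switchingAgents {n k : ℕ} (πN π : Fin k → Finset (Fin n)) : Finset (Fin k) :=
  Finset.univ.filter fun i => πN i ≠ π i

/-- `π` is an optimal routing that, among all optimal routings, has the smallest number of agents
using a path different from the one they use in `πN`. -/
def RingInstance.IsClosestOptimal {n k : ℕ} (I : RingInstance n k)
    (πN π : Fin k → Finset (Fin n)) : Prop :=
  I.IsOptimal π ∧ ∀ π' : Fin k → Finset (Fin n), I.IsOptimal π' →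
    (switchingAgents πN π).card ≤ (switchingAgents πN π').card

/-- The paths in `πN` of the agents that switch between `πN` and `π` cover the ring. -/
def IsCovering {n k : ℕ} (πN π : Fin k → Finset (Fin n)) : Prop :=
  (switchingAgents πN π).biUnion πN = Finset.univ

open Finset

/-! Linear programming duality, checked link by link. Let `s` agents switch, `c` of them avoiding a
link in `πN`; its loads in `πN` and `π` are then `u + s - c` and `u + c`. Adding the equilibrium
conditions with weights `lam` and the bounds on the switchers' latencies in `π` with weights `mu` of
total 3 leaves two inequalities per link (`latency_univ_le_of_weights`). Covering gives `c < s`.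
Equal weights suffice (`latency_univ_le_of_uniform`) unless `s = 5` and some link has `c = 4`; there
the interval structure of paths on the cut ring supplies non-uniform weights
(`latency_univ_le_of_card_five`). -/

theorem mem_ringArc {n : ℕ} {s t e : Fin n} : e ∈ ringArc s t ↔ e - s < t - s := by
  simp [ringArc]

theorem Fin.val_sub_eq_ite {n : ℕ} (x y : Fin n) :
    (x - y).val = if y.val ≤ x.val then x.val - y.val else n - y.val + x.val := by
  have := x.isLt
  have := y.isLt
  rw [Fin.sub_def]
  dsimp only
  split_ifs with hxy
  · rw [show n - y.val + x.val = (x.val - y.val) + n by omega, Nat.add_mod_right]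
    exact Nat.mod_eq_of_lt (by omega)
  · exact Nat.mod_eq_of_lt (by omega)

/-- Cutting the ring at a link `o` outside an arc turns the arc into an interval. -/
theorem exists_interval_of_notMem_ringArc {n : ℕ} {s t o : Fin n} (h : o ∉ ringArc s t) :
    ∃ x y : ℕ, ∀ e, e ∈ ringArc s t ↔ x ≤ (e - o).val ∧ (e - o).val < y := by
  -- An arc ending at `o` has end offset `n`, not 0, unless it is empty.
  refine ⟨(s - o).val, if t = o ∧ s ≠ o then n else (t - o).val, fun e => ?_⟩
  rw [mem_ringArc] at h ⊢
  rw [Fin.lt_def] at h ⊢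
  simp only [Fin.val_sub_eq_ite, Fin.ext_iff, ne_eq] at h ⊢
  have := e.isLt
  have := s.isLt
  have := t.isLt
  have := o.isLt
  split_ifs at h ⊢ <;> omega

theorem IsRingPath.exists_interval {n : ℕ} {s t o : Fin n} {P : Finset (Fin n)}
    (hP : IsRingPath s t P) (h : o ∉ P) :
    ∃ x y : ℕ, ∀ e, e ∈ P ↔ x ≤ (e - o).val ∧ (e - o).val < y := by
  rcases hP with rfl | rfl <;> exact exists_interval_of_notMem_ringArc h

theorem IsRingPath.compl_of_ne {n : ℕ} {s t : Fin n} (hst : s ≠ t) {P Q : Finset (Fin n)}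
    (hP : IsRingPath s t P) (hQ : IsRingPath s t Q) (h : P ≠ Q) : Q = Pᶜ := by
  rcases hP with rfl | rfl <;> rcases hQ with rfl | rfl
  · exact absurd rfl h
  · exact (ringArc_compl hst).symm
  · exact (ringArc_compl hst.symm).symm
  · exact absurd rfl h

/-- Two agents such that every link avoided by some path avoids the path of one of the two. -/
theorem exists_pair_hitting {n k : ℕ} {o : Fin n} {O : Finset (Fin k)} (hO : O.Nonempty)
    {π : Fin k → Finset (Fin n)} (x y : Fin k → ℕ)
    (h : ∀ j ∈ O, ∀ e, e ∈ π j ↔ x j ≤ (e - o).val ∧ (e - o).val < y j) :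
    ∃ p ∈ O, ∃ q ∈ O, ∀ e, (∃ j ∈ O, e ∉ π j) → e ∉ π p ∨ e ∉ π q := by
  -- Take the latest left end and the earliest right end: a link outside some interval lies left of
  -- the former or right of the latter.
  obtain ⟨p, hp, hpx⟩ := O.exists_max_image x hO
  obtain ⟨q, hq, hqy⟩ := O.exists_min_image y hO
  refine ⟨p, hp, q, hq, ?_⟩
  rintro e ⟨j, hj, hje⟩
  rw [h j hj] at hje
  rw [h p hp, h q hq]
  have := hpx j hj
  have := hqy j hj
  omega

/-- The switching agents whose path in `πN` avoids the link `e`. -/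
def switchingAvoiding {n k : ℕ} (πN π : Fin k → Finset (Fin n)) (e : Fin n) : Finset (Fin k) :=
  (switchingAgents πN π).filter fun i => e ∉ πN i

/-! ### Weighted sums of the equilibrium and latency inequalities -/

namespace RingInstance

variable {n k : ℕ} {I : RingInstance n k} {πN π : Fin k → Finset (Fin n)}

theorem latency_le_maxLatency (I : RingInstance n k) (π : Fin k → Finset (Fin n)) (i : Fin k) :
    I.latency (π i) π ≤ I.maxLatency π :=
  le_ciSup (f := fun i => I.latency (π i) π) (Set.finite_range _).bddAbove i

theorem eq_compl_of_mem_switchingAgents (hN : I.IsRouting πN) (hπ : I.IsRouting π) {i : Fin k}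
    (hi : i ∈ switchingAgents πN π) : π i = (πN i)ᶜ :=
  (hN i).compl_of_ne (I.src_ne_dst i) (hπ i) (by simpa [switchingAgents] using hi)

/-- The load of a link in two routings, in terms of the agents that do not switch. -/
theorem exists_load_eq (hN : I.IsRouting πN) (hπ : I.IsRouting π) (e : Fin n) :
    ∃ u : ℕ,
      (univ.filter fun i => e ∈ πN i).card + (switchingAvoiding πN π e).card
        = u + (switchingAgents πN π).card ∧
      (univ.filter fun i => e ∈ π i).card = u + (switchingAvoiding πN π e).card := by
  refine ⟨(univ.filter fun i => e ∈ πN i ∧ i ∉ switchingAgents πN π).card, ?_, ?_⟩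
  · have h1 := card_filter_add_card_filter_not (s := univ.filter fun i => e ∈ πN i)
      (fun i => i ∈ switchingAgents πN π)
    have h2 := card_filter_add_card_filter_not (s := switchingAgents πN π) (fun i => e ∈ πN i)
    rw [filter_filter, filter_filter] at h1
    have h3 : (univ.filter fun i => e ∈ πN i ∧ i ∈ switchingAgents πN π)
        = (switchingAgents πN π).filter fun i => e ∈ πN i := by
      ext i; simp [and_comm]
    rw [h3] at h1
    rw [switchingAvoiding]
    omega
  · have h1 := card_filter_add_card_filter_not (s := univ.filter fun i => e ∈ π i)
      (fun i => i ∈ switchingAgents πN π)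
    rw [filter_filter, filter_filter] at h1
    have h3 : (univ.filter fun i => e ∈ π i ∧ i ∈ switchingAgents πN π)
        = switchingAvoiding πN π e := by
      ext i
      simp only [switchingAvoiding, mem_filter, mem_univ, true_and]
      constructor
      · rintro ⟨h, hi⟩
        rw [eq_compl_of_mem_switchingAgents hN hπ hi, mem_compl] at h
        exact ⟨hi, h⟩
      · rintro ⟨hi, h⟩
        rw [eq_compl_of_mem_switchingAgents hN hπ hi, mem_compl]
        exact ⟨h, hi⟩
    have h4 : (univ.filter fun i => e ∈ π i ∧ i ∉ switchingAgents πN π)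
        = univ.filter fun i => e ∈ πN i ∧ i ∉ switchingAgents πN π := by
      ext i
      simp only [mem_filter, mem_univ, true_and, and_congr_left_iff]
      intro hi
      rw [show πN i = π i by simpa [switchingAgents] using hi]
    rw [h3, h4] at h1
    omega

/-- Split the ring into `πN i` and its complement. The equilibrium condition bounds the first part
by the complement's latency after the deviation, which adds at most one agent per link; hence the
extra `I.a e`. -/
theorem IsNash.latency_univ_le (hN : I.IsNash πN) (i : Fin k) :
    I.latency univ πN ≤ ∑ e ∈ (πN i)ᶜ,
      (2 * (I.a e * ((univ.filter fun j => e ∈ πN j).card : ℝ) + I.b e) + I.a e) := by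
  have h1 : I.latency univ πN = I.latency (πN i) πN + I.latency (πN i)ᶜ πN := by
    unfold latency
    exact (sum_add_sum_compl _ _).symm
  have h2 : I.latency (πN i)ᶜ (Function.update πN i (πN i)ᶜ) ≤ ∑ e ∈ (πN i)ᶜ,
      ((I.a e * ((univ.filter fun j => e ∈ πN j).card : ℝ) + I.b e) + I.a e) := by
    unfold latency
    refine sum_le_sum fun e _ => ?_
    have h3 : (univ.filter fun j => e ∈ Function.update πN i (πN i)ᶜ j).card
        ≤ (univ.filter fun j => e ∈ πN j).card + 1 := by
      refine (card_le_card (t := insert i (univ.filter fun j => e ∈ πN j)) ?_).trans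
        (card_insert_le _ _)
      intro j hj
      by_cases hji : j = i
      · simp [hji]
      · simpa [hji] using hj
    have h4 : ((univ.filter fun j => e ∈ Function.update πN i (πN i)ᶜ j).card : ℝ)
        ≤ ((univ.filter fun j => e ∈ πN j).card : ℝ) + 1 := by exact_mod_cast h3
    have := mul_le_mul_of_nonneg_left h4 (I.a_nonneg e)
    linarith
  have h5 := (hN.2 i).trans h2
  have h6 : ∑ e ∈ (πN i)ᶜ,
      (2 * (I.a e * ((univ.filter fun j => e ∈ πN j).card : ℝ) + I.b e) + I.a e)
      = I.latency (πN i)ᶜ πN + ∑ e ∈ (πN i)ᶜ,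
      ((I.a e * ((univ.filter fun j => e ∈ πN j).card : ℝ) + I.b e) + I.a e) := by
    unfold latency
    rw [← sum_add_distrib]
    exact sum_congr rfl fun e _ => by ring
  linarith

theorem sum_weighted_compl (S : Finset (Fin k)) (w : Fin k → ℝ) (f : Fin n → ℝ) :
    ∑ i ∈ S, w i * ∑ e ∈ (πN i)ᶜ, f e
      = ∑ e, (∑ i ∈ S.filter fun i => e ∉ πN i, w i) * f e := by
  simp_rw [mul_sum, sum_mul]
  exact sum_comm' fun i e => by simp

/-- Weights `lam` for the equilibrium conditions and `mu` for the latencies of the switching agents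
that satisfy two linear conditions on every link bound the total latency. -/
theorem IsNash.latency_univ_le_of_weights (hN : I.IsNash πN) (hπ : I.IsRouting π)
    (lam mu : Fin k → ℝ) (hlam : ∀ i, 0 ≤ lam i) (hmu : ∀ i, 0 ≤ mu i)
    (hmu3 : ∑ i ∈ switchingAgents πN π, mu i = 3)
    (hslope : ∀ e, 1 - ∑ i ∈ switchingAgents πN π, lam i
        + 2 * ∑ i ∈ switchingAvoiding πN π e, lam i ≤ ∑ i ∈ switchingAvoiding πN π e, mu i)
    (hconst : ∀ e, (1 - ∑ i ∈ switchingAgents πN π, lam i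
        + 2 * ∑ i ∈ switchingAvoiding πN π e, lam i)
          * ((switchingAgents πN π).card - (switchingAvoiding πN π e).card)
        + ∑ i ∈ switchingAvoiding πN π e, lam i
      ≤ (∑ i ∈ switchingAvoiding πN π e, mu i) * (switchingAvoiding πN π e).card) :
    I.latency univ πN ≤ 3 * I.maxLatency π := by
  set S := switchingAgents πN π with hS
  have h1 : (∑ i ∈ S, lam i) * I.latency univ πN ≤
      ∑ e, (∑ i ∈ switchingAvoiding πN π e, lam i) *
        (2 * (I.a e * ((univ.filter fun j => e ∈ πN j).card : ℝ) + I.b e) + I.a e) := by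
    unfold switchingAvoiding
    rw [← sum_weighted_compl, sum_mul]
    exact sum_le_sum fun i _ => mul_le_mul_of_nonneg_left (hN.latency_univ_le i) (hlam i)
  have h2 : ∑ e, (∑ i ∈ switchingAvoiding πN π e, mu i) *
        (I.a e * ((univ.filter fun j => e ∈ π j).card : ℝ) + I.b e) ≤ 3 * I.maxLatency π := by
    unfold switchingAvoiding
    rw [← sum_weighted_compl, ← hmu3, sum_mul]
    refine sum_le_sum fun i hi => mul_le_mul_of_nonneg_left ?_ (hmu i)
    have := I.latency_le_maxLatency π i
    rw [eq_compl_of_mem_switchingAgents hN.1 hπ hi] at this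
    exact this
  have h3 : I.latency univ πN + ∑ e, (∑ i ∈ switchingAvoiding πN π e, lam i) *
        (2 * (I.a e * ((univ.filter fun j => e ∈ πN j).card : ℝ) + I.b e) + I.a e)
      ≤ (∑ i ∈ S, lam i) * I.latency univ πN
        + ∑ e, (∑ i ∈ switchingAvoiding πN π e, mu i) *
          (I.a e * ((univ.filter fun j => e ∈ π j).card : ℝ) + I.b e) := by
    unfold latency
    rw [mul_sum, ← sum_add_distrib, ← sum_add_distrib]
    refine sum_le_sum fun e _ => ?_
    obtain ⟨u, hu1, hu2⟩ := exists_load_eq hN.1 hπ e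
    rw [← hS] at hu1
    have hu1' : ((univ.filter fun i => e ∈ πN i).card : ℝ)
        = u + S.card - (switchingAvoiding πN π e).card := by
      rw [eq_sub_iff_add_eq]; exact_mod_cast hu1
    rw [hu1', hu2]
    push_cast
    have ha := I.a_nonneg e
    have hs := hslope e
    -- The three products compare the terms in `b`, in `a * u` and in `a` alone.
    have t1 := mul_le_mul_of_nonneg_left hs (I.b_nonneg e)
    have t2 := mul_le_mul_of_nonneg_left hs (mul_nonneg ha u.cast_nonneg)
    have t3 := mul_le_mul_of_nonneg_left (hconst e) ha
    linarith
  linarith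

/-- The case of equal weights of total `w` for the equilibrium conditions. -/
theorem IsNash.latency_univ_le_of_uniform (hN : I.IsNash πN) (hπ : I.IsRouting π)
    (w : ℝ) (hw : 0 ≤ w) (hpos : 0 < (switchingAgents πN π).card)
    (h : ∀ e, ∀ s c : ℝ, s = (switchingAgents πN π).card → c = (switchingAvoiding πN π e).card →
      s * (1 - w) + 2 * w * c ≤ 3 * c ∧
      (s * (1 - w) + 2 * w * c) * (s - c) + w * c ≤ 3 * c * c) :
    I.latency univ πN ≤ 3 * I.maxLatency π := by
  have hs : (0 : ℝ) < (switchingAgents πN π).card := by exact_mod_cast hpos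
  refine hN.latency_univ_le_of_weights hπ (fun _ => w / (switchingAgents πN π).card)
    (fun _ => 3 / (switchingAgents πN π).card) (fun _ => by positivity) (fun _ => by positivity)
    ?_ ?_ ?_ <;> simp only [sum_const, nsmul_eq_mul]
  · field_simp
  all_goals
    intro e
    obtain ⟨h1, h2⟩ := h e _ _ rfl rfl
    generalize ((switchingAgents πN π).card : ℝ) = s at *
    generalize ((switchingAvoiding πN π e).card : ℝ) = c at *
    rw [← mul_le_mul_iff_right₀ hs]
  · calc _ = s * (1 - w) + 2 * w * c := by field_simp
      _ ≤ 3 * c := h1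
      _ = _ := by field_simp
  · calc _ = (s * (1 - w) + 2 * w * c) * (s - c) + w * c := by field_simp
      _ ≤ 3 * c * c := h2
      _ = _ := by field_simp

theorem card_switchingAvoiding_lt (hcov : IsCovering πN π) (e : Fin n) :
    (switchingAvoiding πN π e).card < (switchingAgents πN π).card := by
  have he : e ∈ (switchingAgents πN π).biUnion πN := hcov ▸ mem_univ e
  obtain ⟨i, hi, hei⟩ := mem_biUnion.1 he
  refine card_lt_card (filter_ssubset.2 ⟨i, hi, by simpa using hei⟩)

/-- Five switching agents, where some link is used by only one of them. -/
theorem IsNash.latency_univ_le_of_card_five (hN : I.IsNash πN) (hπ : I.IsRouting π)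
    (hcov : IsCovering πN π) (h5 : (switchingAgents πN π).card = 5) {o : Fin n}
    (ho : (switchingAvoiding πN π o).card = 4) :
    I.latency univ πN ≤ 3 * I.maxLatency π := by
  set S := switchingAgents πN π with hS
  have hOS : switchingAvoiding πN π o ⊆ S := filter_subset _ _
  have hint : ∀ j, ∃ x y : ℕ, j ∈ switchingAvoiding πN π o →
      ∀ e, e ∈ πN j ↔ x ≤ (e - o).val ∧ (e - o).val < y := by
    intro j
    by_cases hj : j ∈ switchingAvoiding πN π o
    · obtain ⟨x, y, hxy⟩ := (hN.1 j).exists_interval (mem_filter.1 hj).2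
      exact ⟨x, y, fun _ => hxy⟩
    · exact ⟨0, 0, fun h => absurd h hj⟩
  choose x y hxy using hint
  obtain ⟨p, hp, q, hq, hpq⟩ := exists_pair_hitting (card_pos.1 (by omega)) x y hxy
  obtain ⟨V, hpqV, hVS, hV⟩ := exists_subsuperset_card_eq (s := {p, q}) (t := S) (n := 2)
    (by intro j hj; simp only [mem_insert, mem_singleton] at hj; rcases hj with rfl | rfl
        exacts [hOS hp, hOS hq]) card_le_two (by omega)
  have hit : ∀ e, 2 ≤ (switchingAvoiding πN π e).card →
      1 ≤ ((switchingAvoiding πN π e) ∩ V).card := by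
    intro e he
    -- Two sets of sizes at least 2 and 4 among five agents must meet.
    have hmeet : ((switchingAvoiding πN π e) ∩ (switchingAvoiding πN π o)).Nonempty := by
      have h1 := card_union_add_card_inter (switchingAvoiding πN π e) (switchingAvoiding πN π o)
      have h2 : (switchingAvoiding πN π e ∪ switchingAvoiding πN π o).card ≤ S.card :=
        card_le_card (union_subset (filter_subset _ _) hOS)
      exact card_pos.1 (by omega)
    obtain ⟨j, hj⟩ := hmeet
    rw [mem_inter] at hj
    rw [Nat.one_le_iff_ne_zero, ← Nat.pos_iff_ne_zero, card_pos]
    rcases hpq e ⟨j, hj.2, (mem_filter.1 hj.1).2⟩ with h | h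
    · exact ⟨p, mem_inter.2 ⟨mem_filter.2 ⟨hOS hp, h⟩, hpqV (by simp)⟩⟩
    · exact ⟨q, mem_inter.2 ⟨mem_filter.2 ⟨hOS hq, h⟩, hpqV (by simp)⟩⟩
  have hsum : ∀ T : Finset (Fin k), ∑ i ∈ T, (if i ∈ V then (1 / 3 : ℝ) else 7 / 15)
      = 7 / 15 * T.card - 2 / 15 * (T ∩ V).card := by
    intro T
    have h1 : ∀ i, (if i ∈ V then (1 / 3 : ℝ) else 7 / 15)
        = 7 / 15 - if i ∈ V then 2 / 15 else 0 := by
      intro i; split_ifs <;> norm_num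
    simp_rw [h1]
    rw [sum_sub_distrib, sum_const, nsmul_eq_mul, sum_ite_mem, sum_const, nsmul_eq_mul]
    ring
  have hSV : S ∩ V = V := inter_eq_right.2 hVS
  -- With `d` avoiding agents in `V`, the slope condition at `c = 4, d = 1` caps the weight outside
  -- `V` at 7/15; the constant condition at `c = 2, d = 1` then caps the weight on `V` at 1/3.
  refine hN.latency_univ_le_of_weights hπ (fun i => if i ∈ V then 1 / 3 else 7 / 15)
    (fun _ => 3 / 5) (fun i => by split_ifs <;> norm_num) (fun _ => by norm_num)
    ?_ ?_ ?_
  · rw [← hS, sum_const, h5]; norm_num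
  all_goals
    intro e
    rw [← hS, hsum, hsum, hSV, hV, h5, sum_const, nsmul_eq_mul]
    have hlt := card_switchingAvoiding_lt hcov e
    rw [← hS, h5] at hlt
    have hh := hit e
    have hd : ((switchingAvoiding πN π e) ∩ V).card ≤ 2 :=
      hV ▸ card_le_card inter_subset_right
    have hdc : ((switchingAvoiding πN π e) ∩ V).card ≤ (switchingAvoiding πN π e).card :=
      card_le_card inter_subset_left
    have hsd := card_union_add_card_inter (switchingAvoiding πN π e) V
    have hsu : (switchingAvoiding πN π e ∪ V).card ≤ 5 :=
      h5 ▸ card_le_card (union_subset (filter_subset _ _) hVS)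
    generalize ((switchingAvoiding πN π e) ∩ V).card = d at *
    generalize (switchingAvoiding πN π e).card = c at *
    rw [hV] at hsd
    have hcd : c ≤ d + 3 := by omega
    clear hsd hsu
    interval_cases c <;> interval_cases d <;> first | omega | norm_num

end RingInstance

theorem theorem3 {n k : ℕ} (I : RingInstance n k) (πN πS : Fin k → Finset (Fin n))
    (hN : I.IsNash πN) (hS : I.IsClosestOptimal πN πS) (hcov : IsCovering πN πS) :
    I.latency Finset.univ πN ≤ 3 * I.maxLatency πS := by
  have hπ := hS.1.1
  have hlt := RingInstance.card_switchingAvoiding_lt hcov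
  have hpos : 0 < (switchingAgents πN πS).card :=
    (Nat.zero_le _).trans_lt (hlt ⟨0, by have := I.two_le; omega⟩)
  have hone : (switchingAgents πN πS).card ≠ 1 := by
    intro h
    obtain ⟨i, hi⟩ := Finset.card_eq_one.1 h
    have hU : πN i = Finset.univ := by simpa [IsCovering, hi] using hcov
    have h1 : ∀ s t : Fin n, ringArc s t ≠ Finset.univ := by
      intro s t hst
      have : t ∈ ringArc s t := hst ▸ Finset.mem_univ t
      exact lt_irrefl _ (mem_ringArc.1 this)
    rcases hN.1 i with h | h <;> exact h1 _ _ (h.symm.trans hU)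
  -- For `s = 5`, uniform weights of total `w` need `w ≤ 7/3` at `c = 4` but `w ≥ 3` at `c = 2`.
  by_cases hfive : (switchingAgents πN πS).card = 5 ∧
      ∃ o, (switchingAvoiding πN πS o).card = 4
  · obtain ⟨h5, o, ho⟩ := hfive
    exact hN.latency_univ_le_of_card_five hπ hcov h5 ho
  have hsmall : ∀ w : ℕ, (∀ c : ℕ, c < (switchingAgents πN πS).card →
      ¬((switchingAgents πN πS).card = 5 ∧ c = 4) →
      (((switchingAgents πN πS).card : ℤ) * (1 - w) + 2 * w * c ≤ 3 * c ∧
      (((switchingAgents πN πS).card : ℤ) * (1 - w) + 2 * w * c)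
        * ((switchingAgents πN πS).card - c) + w * c ≤ 3 * c * c)) →
      I.latency Finset.univ πN ≤ 3 * I.maxLatency πS := by
    intro w hw
    refine hN.latency_univ_le_of_uniform hπ w w.cast_nonneg hpos ?_
    rintro e s c rfl rfl
    have := hw _ (hlt e) fun hc => hfive ⟨hc.1, e, hc.2⟩
    exact_mod_cast this
  generalize (switchingAgents πN πS).card = s at *
  rcases lt_or_ge s 7 with h7 | h7
  · interval_cases s
    · exact absurd rfl hone
    · refine hsmall 1 fun c hc _ => ?_
      interval_cases c <;> norm_num
    · refine hsmall 3 fun c hc _ => ?_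
      interval_cases c <;> norm_num
    · refine hsmall 2 fun c hc _ => ?_
      interval_cases c <;> norm_num
    · refine hsmall 3 fun c hc hc' => ?_
      interval_cases c <;> omega
    · refine hsmall 2 fun c hc _ => ?_
      interval_cases c <;> norm_num
  · refine hsmall 2 fun c hc _ => ?_
    have h7' : (7 : ℤ) ≤ s := by exact_mod_cast h7
    have hc' : (c : ℤ) + 1 ≤ s := by exact_mod_cast hc
    generalize (s : ℤ) = s at *
    generalize (c : ℤ) = c at *
    push_cast
    constructor
    · linarith
    -- The claim is `7c² - 5cs + s² - 2c ≥ 0`; 28 times the left side is `(14c - 5s - 2)² + 3s² -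
    -- 20s - 4`, and the remainder is positive from `s = 7` on.
    · nlinarith [sq_nonneg (14 * c - 5 * s - 2), mul_nonneg (sub_nonneg.2 h7') (sub_nonneg.2 h7')]
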